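/- Let $M$ be a compact connected smooth surface (without boundary, Hausdorff), and let $Q\subset M$ be a fixed set of $k\ge 0$ distinct points. Let $\mathrm{D}(M)$ be either the group $\mathrm{Diff}(M)$ of all smooth diffeomorphisms of $M$, or, if $M$ is orientable, the group $\mathrm{Diff}^+(M)$ of orientation preserving ones, with the compact-open topology. Let $\mathrm{D}_0(M)$ be the path component of the identity in $\mathrm{D}(M)$ (the diffeomorphisms isotopic to the identity), and let $\mathrm{D}(M;k)\subset \mathrm{D}(M)$ be the subgroup of those diffeomorphisms $f$ with $f(Q)=Q$ (the points may be permuted); subgroups carry the subspace topology. Put $$\Gamma(M)=\pi_0\,\mathrm{D}(M),\qquad \Gamma^k(M)=\pi_0\,\mathrm{D}(M;k),\qquad \widetilde\Gamma^k(M)=\pi_0\bigl(\mathrm{D}_0(M)\cap \mathrm{D}(M;k)\bigr),$$ the groups of path components. Then the homomorphism $\widetilde\Gamma^k(M)\to\Gamma^k(M)$ induced by inclusion is injective, so that the reduced mapping class group $\widetilde\Gamma^k(M)$ is naturally a subgroup of $\Gamma^k(M)$, and the homomorphisms induced by the inclusions form a short exact sequence of groups $$1\longrightarrow\widetilde\Gamma^k(M)\longrightarrow\Gamma^k(M)\longrightarrow\Gamma(M)\longrightarrow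 1 .$$ -/

import Mathlib

open scoped Manifold ContDiff Topology

noncomputable section

/-! ### The group of path components of a topological group -/

section PiZero

variable {G H : Type*} [Group G] [TopologicalSpace G] [IsTopologicalGroup G]
  [Group H] [TopologicalSpace H] [IsTopologicalGroup H]

/-- `π₀ G`, the set of path components of a topological group `G`, with the group structure
induced from `G`. -/
instance ZerothHomotopy.instGroup : Group (ZerothHomotopy G) where
  mul := Quotient.map₂ (· * ·) fun _ _ h₁ _ _ h₂ => Joined.mul h₁ h₂
  one := ZerothHomotopy.mk 1
  inv := Quotient.map (·⁻¹) fun _ _ h => Joined.map h continuous_inv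
  mul_assoc := by
    rintro ⟨a⟩ ⟨b⟩ ⟨c⟩
    exact congrArg ZerothHomotopy.mk (mul_assoc a b c)
  one_mul := by
    rintro ⟨a⟩
    exact congrArg ZerothHomotopy.mk (one_mul a)
  mul_one := by
    rintro ⟨a⟩
    exact congrArg ZerothHomotopy.mk (mul_one a)
  inv_mul_cancel := by
    rintro ⟨a⟩
    exact congrArg ZerothHomotopy.mk (inv_mul_cancel a)

theorem ZerothHomotopy.mk_mul (a b : G) :
    ZerothHomotopy.mk (a * b) = ZerothHomotopy.mk a * ZerothHomotopy.mk b := rfl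

/-- The homomorphism `π₀ G → π₀ H` induced by a continuous homomorphism `G → H`. -/
def piZeroMap (φ : G →* H) (hφ : Continuous φ) : ZerothHomotopy G →* ZerothHomotopy H where
  toFun := Quotient.map φ fun _ _ h => Joined.map h hφ
  map_one' := congrArg ZerothHomotopy.mk (map_one φ)
  map_mul' := by
    rintro ⟨a⟩ ⟨b⟩
    exact congrArg ZerothHomotopy.mk (map_mul φ a b)

theorem piZeroMap_mk (φ : G →* H) (hφ : Continuous φ) (a : G) :
    piZeroMap φ hφ (ZerothHomotopy.mk a) = ZerothHomotopy.mk (φ a) := rfl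

/-- The homomorphism `π₀ A → π₀ B` induced by an inclusion of subgroups `A ≤ B` of `G`, both with
the subspace topology. -/
def piZeroInclusion {A B : Subgroup G} (h : A ≤ B) : ZerothHomotopy A →* ZerothHomotopy B :=
  piZeroMap (Subgroup.inclusion h) (continuous_inclusion h)

end PiZero

/-! ### The group of diffeomorphisms of a surface -/

/-- The smooth diffeomorphisms of the surface `M` onto itself. -/
abbrev SurfaceDiff (M : Type*) [TopologicalSpace M]
    [ChartedSpace (EuclideanSpace ℝ (Fin 2)) M] : Type _ :=
  M ≃ₘ⟮𝓡 2, 𝓡 2⟯ M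

namespace SurfaceDiff

section Basic

variable {M : Type*} [TopologicalSpace M] [ChartedSpace (EuclideanSpace ℝ (Fin 2)) M]

/-- The group structure: multiplication is composition. -/
instance : Group (SurfaceDiff M) where
  mul f g := Diffeomorph.trans g f
  one := Diffeomorph.refl (𝓡 2) M ∞
  inv f := f.symm
  mul_assoc _ _ _ := rfl
  one_mul _ := rfl
  mul_one _ := rfl
  inv_mul_cancel f := Diffeomorph.ext fun x => f.symm_apply_apply x

theorem mul_apply (f g : SurfaceDiff M) (x : M) : (f * g) x = f (g x) := rfl

theorem one_apply (x : M) : (1 : SurfaceDiff M) x = x := rfl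

theorem inv_eq_symm (f : SurfaceDiff M) : f⁻¹ = f.symm := rfl

theorem inv_apply_self (f : SurfaceDiff M) (x : M) : f⁻¹ (f x) = x := f.symm_apply_apply x

theorem apply_inv_self (f : SurfaceDiff M) (x : M) : f (f⁻¹ x) = x := f.apply_symm_apply x

/-- The continuous map underlying a diffeomorphism. -/
def toC (f : SurfaceDiff M) : C(M, M) := ⟨f, f.continuous⟩

/-- The compact-open topology. -/
instance : TopologicalSpace (SurfaceDiff M) :=
  TopologicalSpace.induced toC ContinuousMap.compactOpen

theorem continuous_toC : Continuous (toC (M := M)) := continuous_induced_dom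

/-- For compact Hausdorff `M`, composition and inversion are continuous. -/
instance [CompactSpace M] [T2Space M] : IsTopologicalGroup (SurfaceDiff M) where
  continuous_mul := continuous_induced_rng.2 <|
    ContinuousMap.continuous_comp'.comp
      ((continuous_toC.comp continuous_snd).prodMk (continuous_toC.comp continuous_fst))
  continuous_inv := by
    refine continuous_induced_rng.2 (ContinuousMap.continuous_of_continuous_uncurry _ ?_)
    have hev : Continuous fun q : SurfaceDiff M × M => q.1 q.2 :=
      (continuous_toC.comp continuous_fst).eval continuous_snd
    rw [continuous_iff_isClosed]
    intro s hs
    have hset : (Function.uncurry fun (f : SurfaceDiff M) (x : M) => toC f⁻¹ x) ⁻¹' s =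
        Prod.fst '' {p : (SurfaceDiff M × M) × M | p.1.1 p.2 = p.1.2 ∧ p.2 ∈ s} := by
      ext ⟨f, x⟩
      constructor
      · intro h
        exact ⟨((f, x), f⁻¹ x), ⟨apply_inv_self f x, h⟩, rfl⟩
      · rintro ⟨⟨⟨g, y⟩, z⟩, ⟨h1, h2⟩, h3⟩
        obtain ⟨rfl, rfl⟩ := Prod.mk.inj h3
        change g⁻¹ y ∈ s
        have h1' : g z = y := h1
        rw [← h1', inv_apply_self]
        exact h2
    refine Eq.subst (motive := IsClosed) hset.symm ?_
    refine isClosedMap_fst_of_compactSpace _ (IsClosed.inter ?_ (hs.preimage continuous_snd))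
    exact isClosed_eq
      (hev.comp ((continuous_fst.comp continuous_fst).prodMk continuous_snd))
      (continuous_snd.comp continuous_fst)

/-- The group of diffeomorphisms that leave the set of marked points `Q` invariant (the marked
points may be permuted). -/
def stabilizer (Q : Finset M) : Subgroup (SurfaceDiff M) where
  carrier := {f | f '' (Q : Set M) = Q}
  mul_mem' {f g} hf hg := by
    change (fun x => f (g x)) '' (Q : Set M) = Q
    rw [← Set.image_image (fun x => f x) (fun x => g x)]
    exact (congrArg _ hg).trans hf
  one_mem' := Set.image_id _
  inv_mem' {f} hf := by
    change (fun x => f⁻¹ x) '' (Q : Set M) = Q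
    have hf' : f '' (Q : Set M) = Q := hf
    conv_lhs => rw [← hf']
    rw [Set.image_image]
    simp [inv_apply_self]

end Basic

/-! ### Orientations -/

section Orientation

variable {M : Type*} [TopologicalSpace M] [ChartedSpace (EuclideanSpace ℝ (Fin 2)) M]

/-- The bijection from orientations of `T_x M` to orientations of `T_{f x} M` induced by the
differential of the diffeomorphism `f` at `x`. -/
def mapOrientation (f : SurfaceDiff M) (x : M) :
    Orientation ℝ (TangentSpace (𝓡 2) x) (Fin 2) ≃
      Orientation ℝ (TangentSpace (𝓡 2) (f x)) (Fin 2) :=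
  Orientation.map (Fin 2)
    (f.mfderivToContinuousLinearEquiv (by simp) x).toLinearEquiv

theorem mapOrientation_mul (f g : SurfaceDiff M) (x : M)
    (o : Orientation ℝ (TangentSpace (𝓡 2) x) (Fin 2)) :
    (f * g).mapOrientation x o = f.mapOrientation (g x) (g.mapOrientation x o) := by
  have he : ((f * g).mfderivToContinuousLinearEquiv (by simp) x).toLinearEquiv =
      (g.mfderivToContinuousLinearEquiv (by simp) x).toLinearEquiv.trans
        (f.mfderivToContinuousLinearEquiv (by simp) (g x)).toLinearEquiv := by
    ext1 v
    have h := mfderiv_comp x (f.mdifferentiable (by simp) (g x)) (g.mdifferentiable (by simp) x)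
    exact congrArg (fun L => L v) h
  unfold mapOrientation
  rw [he]
  induction o using Module.Ray.ind with
  | h v hv => rfl

theorem mapOrientation_one (x : M) (o : Orientation ℝ (TangentSpace (𝓡 2) x) (Fin 2)) :
    (1 : SurfaceDiff M).mapOrientation x o = o := by
  have h := mapOrientation_mul (1 : SurfaceDiff M) 1 x o
  exact ((1 : SurfaceDiff M).mapOrientation x).injective h.symm

variable [IsManifold (𝓡 2) ∞ M]

/-- `o`, a choice of an orientation of every tangent space of `M`, is an orientation of `M`: it is
locally constant in the standard local trivializations of the tangent bundle. -/
def IsOrientation (o : ∀ x : M, Orientation ℝ (TangentSpace (𝓡 2) x) (Fin 2)) : Prop :=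
  ∀ x₀ : M, ∃ o₀ : Orientation ℝ (EuclideanSpace ℝ (Fin 2)) (Fin 2), ∀ᶠ x in 𝓝 x₀,
    ∃ hx : x ∈ (trivializationAt (EuclideanSpace ℝ (Fin 2)) (TangentSpace (𝓡 2) (M := M))
        x₀).baseSet,
      Orientation.map (Fin 2)
        ((trivializationAt (EuclideanSpace ℝ (Fin 2)) (TangentSpace (𝓡 2) (M := M))
          x₀).continuousLinearEquivAt ℝ x hx).toLinearEquiv (o x) = o₀

variable (M) in
/-- The group of diffeomorphisms that preserve every orientation of `M`. If `M` is connected and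
orientable, it has exactly two orientations, opposite to each other, and this is the group
`Diff⁺(M)` of orientation preserving diffeomorphisms; if `M` is not orientable, it is the group of
all diffeomorphisms. -/
def orientationPreserving : Subgroup (SurfaceDiff M) where
  carrier := {f | ∀ o, IsOrientation o → ∀ x, f.mapOrientation x (o x) = o (f x)}
  mul_mem' {f g} hf hg o ho x := by
    rw [mapOrientation_mul, hg o ho x]
    exact hf o ho (g x)
  one_mem' o _ x := mapOrientation_one x (o x)
  inv_mem' {f} hf o ho x := by
    refine (f.mapOrientation (f⁻¹ x)).injective ?_
    rw [← mapOrientation_mul]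
    refine Eq.trans ?_ (hf o ho (f⁻¹ x)).symm
    have key : ∀ (k : SurfaceDiff M), k = 1 → ∀ y : M, k.mapOrientation y (o y) = o (k y) := by
      rintro k rfl y
      exact mapOrientation_one y (o y)
    exact key (f * f⁻¹) (mul_inv_cancel f) x

end Orientation

/-! ### Mapping class groups

Here `D` is a group of diffeomorphisms of `M`, with the (subspace topology of the) compact-open
topology. It will be the group of all diffeomorphisms, or the group of orientation preserving
ones. -/

section MappingClassGroup

variable {M : Type*} [TopologicalSpace M] [ChartedSpace (EuclideanSpace ℝ (Fin 2)) M]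

/-- `D(Q)`: the elements of `D` that leave the set `Q` of marked points invariant. -/
def marked (D : Subgroup (SurfaceDiff M)) (Q : Finset M) : Subgroup (SurfaceDiff M) :=
  D ⊓ stabilizer Q

theorem marked_le (D : Subgroup (SurfaceDiff M)) (Q : Finset M) : marked D Q ≤ D := inf_le_left

variable [CompactSpace M] [T2Space M]

/-- `D₀`: the path component of the identity in `D`, that is, the elements of `D` that are isotopic
to the identity through elements of `D`. -/
def idComponent (D : Subgroup (SurfaceDiff M)) : Subgroup (SurfaceDiff M) :=
  (Subgroup.pathComponentOne D).map D.subtype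

/-- `D₀ ∩ D(Q)`. -/
def reducedMarked (D : Subgroup (SurfaceDiff M)) (Q : Finset M) : Subgroup (SurfaceDiff M) :=
  idComponent D ⊓ marked D Q

theorem reducedMarked_le (D : Subgroup (SurfaceDiff M)) (Q : Finset M) :
    reducedMarked D Q ≤ marked D Q := inf_le_right

/-- The mapping class group `Γ(M) = π₀ D`. -/
abbrev MappingClassGroup (D : Subgroup (SurfaceDiff M)) : Type _ := ZerothHomotopy D

/-- The mapping class group with marked points, `Γᵏ(M) = π₀ D(Q)`, with `k` the number of elements
of `Q`. -/
abbrev MarkedMappingClassGroup (D : Subgroup (SurfaceDiff M)) (Q : Finset M) : Type _ :=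
  ZerothHomotopy (marked D Q)

/-- The reduced mapping class group with marked points, `π₀ (D₀ ∩ D(Q))`. -/
abbrev ReducedMappingClassGroup (D : Subgroup (SurfaceDiff M)) (Q : Finset M) : Type _ :=
  ZerothHomotopy (reducedMarked D Q)

/-- The homomorphism from the reduced mapping class group to `Γᵏ(M)` induced by inclusion. -/
def reducedToMarked (D : Subgroup (SurfaceDiff M)) (Q : Finset M) :
    ReducedMappingClassGroup D Q →* MarkedMappingClassGroup D Q :=
  piZeroInclusion (reducedMarked_le D Q)

/-- The homomorphism `Γᵏ(M) → Γ(M)` induced by inclusion (forgetting the marked points). -/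
def forgetMarked (D : Subgroup (SurfaceDiff M)) (Q : Finset M) :
    MarkedMappingClassGroup D Q →* MappingClassGroup D :=
  piZeroInclusion (marked_le D Q)

end MappingClassGroup

end SurfaceDiff

end

/-! Exactness in the middle and injectivity are formal and hold for every subgroup `D`. A class in
π₀ D(Q) dies in π₀ D exactly when its representative lies in D₀, and D₀ ∩ D(Q) is a union of path
components of D(Q), because a path in D(Q) is a path in D.

The geometry is in surjectivity. Given f in `D`, it is enough to find h in D₀ carrying f(Q) back to
Q: then h ∘ f lies in D(Q) and is joined to f in `D`. So D₀ must act transitively on the k-point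
subsets of M (`exists_idComponent_image_eq`). Points are moved one at a time, the points already
placed being fixed, which reduces to moving p to q off a finite set C by an isotopy fixing C
(`exists_idComponent_apply_eq`). Since M \ C is connected (`isPreconnected_compl_finset`), it
suffices to do this for q near p (`eventually_exists_idComponent`). There z ↦ z + tφ(z)v, with φ a
bump function in a chart and v small, is a contraction perturbation of the identity, hence a
diffeomorphism, and extends by the identity to M.

These isotopies also lie in the orientation preserving group: the set where a diffeomorphism
preserves a given orientation is open and closed, and it contains the points near which the
diffeomorphism is the identity (`mem_orientationPreserving_of_eventuallyEq_id`). -/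

/-! ### Compactly supported perturbations of the identity of a Euclidean space -/

section Bump

variable {E : Type*} [NormedAddCommGroup E] [InnerProductSpace ℝ E] [FiniteDimensional ℝ E]

/-- A smooth contraction perturbs the identity to a smooth homeomorphism with smooth inverse. -/
theorem exists_homeomorph_add_of_lipschitzWith {g : E → E} (hg : ContDiff ℝ ∞ g)
    {K : NNReal} (hK : K < 1) (hL : LipschitzWith K g) :
    ∃ h : E ≃ₜ E, (∀ z, h z = z + g z) ∧ ContDiff ℝ ∞ h ∧ ContDiff ℝ ∞ h.symm := by
  rcases subsingleton_or_nontrivial E with hE | hE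
  · exact ⟨Homeomorph.refl E, fun z => Subsingleton.elim _ _, contDiff_id, contDiff_id⟩
  have happ : ApproximatesLinearOn (fun z => z + g z)
      ((ContinuousLinearEquiv.refl ℝ E : E ≃L[ℝ] E) : E →L[ℝ] E) Set.univ K := by
    intro x _ y _
    have := hL.dist_le_mul x y
    rw [dist_eq_norm, dist_eq_norm] at this
    have h : (fun z => z + g z) x - (fun z => z + g z) y -
        ((ContinuousLinearEquiv.refl ℝ E : E ≃L[ℝ] E) : E →L[ℝ] E) (x - y) = g x - g y := by
      change (x + g x) - (y + g y) - (x - y) = g x - g y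
      abel
    rwa [h]
  -- On a nontrivial space the identity has norm one, so the required bound is just K < 1.
  have hc : Subsingleton E ∨ K <
      ‖(((ContinuousLinearEquiv.refl ℝ E).symm : E ≃L[ℝ] E) : E →L[ℝ] E)‖₊⁻¹ := by
    right
    have : (((ContinuousLinearEquiv.refl ℝ E).symm : E ≃L[ℝ] E) : E →L[ℝ] E) =
      ContinuousLinearMap.id ℝ E := rfl
    rw [this]
    simpa using hK
  have hd : ContDiff ℝ ∞ fun z => z + g z := contDiff_id.add hg
  -- The derivative 1 + g'(a) is invertible by the Neumann series, written as 1 - (-g'(a)) to fit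
  -- `Units.oneSub`. This makes the inverse smooth.
  have hn : ∀ a, ‖-fderiv ℝ g a‖ < 1 := fun a => by
    rw [norm_neg]
    exact (norm_fderiv_le_of_lipschitz ℝ hL).trans_lt hK
  refine ⟨happ.toHomeomorph _ hc, fun z => rfl, hd, ?_⟩
  refine Homeomorph.contDiff_symm (n := ∞) (happ.toHomeomorph _ hc)
    (f₀' := fun a => ContinuousLinearEquiv.unitsEquiv ℝ E (Units.oneSub _ (hn a))) (fun a => ?_) hd
  have h1 : HasFDerivAt (fun z => z + g z) (ContinuousLinearMap.id ℝ E + fderiv ℝ g a) a :=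
    (hasFDerivAt_id a).add (hg.differentiable (by simp) a).hasFDerivAt
  have h2 : (ContinuousLinearEquiv.unitsEquiv ℝ E (Units.oneSub _ (hn a)) : E →L[ℝ] E) =
      ContinuousLinearMap.id ℝ E + fderiv ℝ g a := by
    ext v
    change (1 - -fderiv ℝ g a) v = _
    simp
  rw [h2]
  exact h1

/-- The maps `z ↦ z + φ z • v`, with `φ` a bump function at `p` and `v` a small vector, are
diffeomorphisms. -/
theorem exists_bump_homeomorph (p : E) {r : ℝ} (hr : 0 < r) :
    ∃ φ : E → ℝ, Continuous φ ∧ φ p = 1 ∧ (∀ z ∉ Metric.closedBall p r, φ z = 0) ∧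
      ∃ ε > 0, ∀ v : E, ‖v‖ < ε → ∃ h : E ≃ₜ E, (∀ z, h z = z + φ z • v) ∧
        ContDiff ℝ ∞ h ∧ ContDiff ℝ ∞ h.symm := by
  let φ : ContDiffBump p := ⟨r / 2, r, by positivity, by linarith⟩
  have hφ : ContDiff ℝ ∞ φ := φ.contDiff
  obtain ⟨K, hK⟩ := hφ.lipschitzWith_of_hasCompactSupport φ.hasCompactSupport (by simp)
  -- With φ K-Lipschitz, φ • v is K‖v‖-Lipschitz. The bound 1/(K + 1) on ‖v‖ makes this constant
  -- less than 1, also when K = 0.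
  refine ⟨φ, φ.continuous, φ.one_of_mem_closedBall (Metric.mem_closedBall_self φ.rIn_pos.le),
    fun z hz => φ.zero_of_le_dist ?_, (K + 1 : ℝ)⁻¹, by positivity, fun v hv => ?_⟩
  · rw [Metric.mem_closedBall, not_le] at hz
    exact hz.le
  refine exists_homeomorph_add_of_lipschitzWith (g := fun z => φ z • v)
    (hφ.smul contDiff_const) (K := K * ‖v‖₊) ?_ ?_
  · rw [← NNReal.coe_lt_coe]
    push_cast
    have h1 : ‖v‖ * (K + 1) < 1 := by
      rwa [← one_div, lt_div_iff₀ (by positivity)] at hv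
    nlinarith [norm_nonneg v]
  · refine LipschitzWith.of_dist_le_mul fun x y => ?_
    rw [dist_eq_norm, ← sub_smul, norm_smul]
    have := hK.dist_le_mul x y
    rw [dist_eq_norm] at this
    push_cast
    nlinarith [norm_nonneg v]

end Bump

/-! ### Complements of finite sets in a surface -/

section Connected

variable {E : Type*} [NormedAddCommGroup E] [NormedSpace ℝ E]

/-- `univBall` identifies the whole space with the ball and 0 with its centre, and the space minus a
point is connected in dimension greater than one. -/
theorem isPreconnected_ball_diff_center (hE : 1 < Module.rank ℝ E) (p : E) (r : ℝ) :
    IsPreconnected (Metric.ball p r \ {p}) := by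
  rcases le_or_gt r 0 with hr | hr
  · rw [Metric.ball_eq_empty.2 hr, Set.empty_sdiff]
    exact isPreconnected_empty
  let e := OpenPartialHomeomorph.univBall p r
  have he : e 0 = p := OpenPartialHomeomorph.univBall_apply_zero p r
  have hs : e.source = Set.univ := OpenPartialHomeomorph.univBall_source p r
  have ht : e.target = Metric.ball p r := OpenPartialHomeomorph.univBall_target p hr
  have hc : ContinuousOn e {0}ᶜ := e.continuousOn.mono (by simp [hs])
  convert (isConnected_compl_singleton_of_one_lt_rank hE (0 : E)).isPreconnected.image e hc using 1
  ext y
  constructor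
  · rintro ⟨hy, hne⟩
    rw [← ht] at hy
    refine ⟨e.symm y, fun h0 => hne ?_, e.right_inv hy⟩
    rw [Set.mem_singleton_iff] at h0 ⊢
    rw [← e.right_inv hy, h0, he]
  · rintro ⟨x, hx, rfl⟩
    refine ⟨ht ▸ e.map_source (by simp [hs]), fun h0 => hx ?_⟩
    rw [Set.mem_singleton_iff, ← he] at h0
    exact e.injOn (by simp [hs]) (by simp [hs]) h0

/-- Removing a point with arbitrarily small connected punctured neighbourhoods keeps an open set
connected. -/
theorem IsPreconnected.diff_singleton_of_punctured {X : Type*} [TopologicalSpace X] [T1Space X]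
    {U V : Set X} {c : X} (hU : IsPreconnected U) (hV : IsOpen V) (hc : c ∈ V) (hVU : V ⊆ U)
    (hVc : IsPreconnected (V \ {c})) : IsPreconnected (U \ {c}) := by
  -- If the punctured neighbourhood lies on the side S, the point c can be given to S: S ∪ V and T \
  -- {c} cover U, so they meet by connectedness, and a common point is not c, hence lies in S ∩ T.
  have key : ∀ S T : Set X, IsOpen S → IsOpen T → U \ {c} ⊆ S ∪ T → U \ {c} ∩ (S ∩ T) = ∅ →
      (U \ {c} ∩ T).Nonempty → V \ {c} ⊆ S → False := by
    rintro S T hS hT hST hd ⟨t, ht, htT⟩ hVS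
    have hcov : U ⊆ (S ∪ V) ∪ (T \ {c}) := fun x hx => by
      by_cases hxc : x = c
      · exact Or.inl (Or.inr (hxc ▸ hc))
      · rcases hST ⟨hx, hxc⟩ with h | h
        · exact Or.inl (Or.inl h)
        · exact Or.inr ⟨h, hxc⟩
    obtain ⟨z, hzU, hzS, hzT, hzc⟩ := hU (S ∪ V) (T \ {c}) (hS.union hV)
      (hT.sdiff isClosed_singleton) hcov ⟨c, hVU hc, Or.inr hc⟩ ⟨t, ht.1, htT, ht.2⟩
    have : z ∈ U \ {c} ∩ (S ∩ T) :=
      ⟨⟨hzU, hzc⟩, hzS.elim id fun h => hVS ⟨h, hzc⟩, hzT⟩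
    rw [hd] at this
    exact this
  intro S T hS hT hST hSn hTn
  by_contra hne
  rw [Set.not_nonempty_iff_eq_empty] at hne
  rcases isPreconnected_iff_subset_of_disjoint.1 hVc S T hS hT
    ((Set.sdiff_subset_sdiff_left hVU).trans hST)
    (Set.subset_eq_empty (Set.inter_subset_inter_left _ (Set.sdiff_subset_sdiff_left hVU)) hne)
    with h | h
  · exact key S T hS hT hST hne hTn h
  · exact key T S hT hS (by rwa [Set.union_comm]) (by rwa [Set.inter_comm T S]) hSn h

/-- The points are removed one at a time. A small chart ball around the new point c misses the
earlier points and stays connected without its centre. -/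
theorem isPreconnected_compl_finset (hE : 1 < Module.rank ℝ E) {M : Type*} [TopologicalSpace M]
    [ChartedSpace E M] [T2Space M] [PreconnectedSpace M] (C : Finset M) :
    IsPreconnected ((C : Set M)ᶜ) := by
  classical
  induction C using Finset.induction_on with
  | empty => simpa using isPreconnected_univ
  | insert c C hc ih =>
    have hset : ((insert c C : Finset M) : Set M)ᶜ = (C : Set M)ᶜ \ {c} := by
      ext x
      simp [not_or, and_comm]
    rw [hset]
    let e := chartAt E c
    have hCo : IsOpen ((C : Set M)ᶜ) := C.finite_toSet.isClosed.isOpen_compl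
    have hW : IsOpen (e.target ∩ e.symm ⁻¹' (C : Set M)ᶜ) := e.isOpen_inter_preimage_symm hCo
    have hcs : c ∈ e.source := mem_chart_source E c
    have hcW : e c ∈ e.target ∩ e.symm ⁻¹' (C : Set M)ᶜ :=
      ⟨e.map_source hcs, by rw [Set.mem_preimage, e.left_inv hcs]; simpa using hc⟩
    obtain ⟨r, hr, hball⟩ := Metric.isOpen_iff.1 hW _ hcW
    have himg : e.symm '' (Metric.ball (e c) r \ {e c}) =
        e.symm '' Metric.ball (e c) r \ {c} := by
      ext x
      constructor
      · rintro ⟨y, ⟨hy, hne⟩, rfl⟩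
        refine ⟨⟨y, hy, rfl⟩, fun h0 => hne ?_⟩
        rw [Set.mem_singleton_iff] at h0 ⊢
        rw [← h0, e.right_inv (hball hy).1]
      · rintro ⟨⟨y, hy, rfl⟩, hne⟩
        refine ⟨y, ⟨hy, fun h0 => hne ?_⟩, rfl⟩
        rw [Set.mem_singleton_iff] at h0 ⊢
        rw [h0, e.left_inv hcs]
    refine ih.diff_singleton_of_punctured (V := e.symm '' Metric.ball (e c) r)
      (e.symm.isOpen_image_of_subset_source Metric.isOpen_ball fun y hy => (hball hy).1)
      ⟨e c, Metric.mem_ball_self hr, e.left_inv hcs⟩ ?_ ?_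
    · rintro _ ⟨y, hy, rfl⟩
      exact (hball hy).2
    · rw [← himg]
      exact (isPreconnected_ball_diff_center hE _ _).image _
        (e.continuousOn_symm.mono fun y hy => (hball hy.1).1)

end Connected

namespace SurfaceDiff

/-! ### Diffeomorphisms supported in a chart -/

section ChartExtend

variable {M : Type*} [TopologicalSpace M] [ChartedSpace (EuclideanSpace ℝ (Fin 2)) M]

open Classical in
/-- The map `g`, read in the chart at `c`, extended by the identity outside of the chart. -/
noncomputable def chartExtend (c : M)
    (g : EuclideanSpace ℝ (Fin 2) → EuclideanSpace ℝ (Fin 2)) (x : M) : M :=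
  if x ∈ (chartAt (EuclideanSpace ℝ (Fin 2)) c).source then
    (chartAt (EuclideanSpace ℝ (Fin 2)) c).symm (g (chartAt (EuclideanSpace ℝ (Fin 2)) c x))
  else x

variable {c : M} {K : Set (EuclideanSpace ℝ (Fin 2))}
  {g : EuclideanSpace ℝ (Fin 2) → EuclideanSpace ℝ (Fin 2)}

theorem chartExtend_of_mem {x : M}
    (hx : x ∈ (chartAt (EuclideanSpace ℝ (Fin 2)) c).source) :
    chartExtend c g x = (chartAt (EuclideanSpace ℝ (Fin 2)) c).symm
      (g (chartAt (EuclideanSpace ℝ (Fin 2)) c x)) := if_pos hx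

theorem chartExtend_of_notMem
    (hg : ∀ z ∉ K, g z = z) {x : M}
    (hx : x ∉ (chartAt (EuclideanSpace ℝ (Fin 2)) c).symm '' K) : chartExtend c g x = x := by
  by_cases hs : x ∈ (chartAt (EuclideanSpace ℝ (Fin 2)) c).source
  · rw [chartExtend_of_mem hs, hg, OpenPartialHomeomorph.left_inv _ hs]
    exact fun h => hx ⟨_, h, OpenPartialHomeomorph.left_inv _ hs⟩
  · exact if_neg hs

theorem isClosed_chart_symm_image [T2Space M] (hKc : IsCompact K)
    (hK : K ⊆ (chartAt (EuclideanSpace ℝ (Fin 2)) c).target) :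
    IsClosed ((chartAt (EuclideanSpace ℝ (Fin 2)) c).symm '' K) :=
  (hKc.image_of_continuousOn
    ((OpenPartialHomeomorph.continuousOn_symm _).mono hK)).isClosed

/-- The chart domain and the complement of the image of K cover M. Both are open, the second because
a compact set is closed in the Hausdorff space M; on the first the map is g in the chart, on the
second the identity. -/
theorem contMDiff_chartExtend [IsManifold (𝓡 2) ∞ M] [T2Space M] (hKc : IsCompact K)
    (hK : K ⊆ (chartAt (EuclideanSpace ℝ (Fin 2)) c).target) (hg : ∀ z ∉ K, g z = z)
    (hgd : ContDiff ℝ ∞ g)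
    (hgt : Set.MapsTo g (chartAt (EuclideanSpace ℝ (Fin 2)) c).target
      (chartAt (EuclideanSpace ℝ (Fin 2)) c).target) :
    ContMDiff (𝓡 2) (𝓡 2) ∞ (chartExtend c g) := by
  intro x
  by_cases hx : x ∈ (chartAt (EuclideanSpace ℝ (Fin 2)) c).symm '' K
  · have hs : x ∈ (chartAt (EuclideanSpace ℝ (Fin 2)) c).source := by
      obtain ⟨y, hy, rfl⟩ := hx
      exact OpenPartialHomeomorph.map_target _ (hK hy)
    have hnhds := (chartAt (EuclideanSpace ℝ (Fin 2)) c).open_source.mem_nhds hs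
    have h1 : ContMDiffOn (𝓡 2) (𝓡 2) ∞ (fun y => (chartAt (EuclideanSpace ℝ (Fin 2)) c).symm
        (g (chartAt (EuclideanSpace ℝ (Fin 2)) c y)))
        (chartAt (EuclideanSpace ℝ (Fin 2)) c).source := by
      refine (contMDiffOn_chart_symm (I := 𝓡 2) (x := c) (n := ∞)).comp
        (hgd.contMDiff.comp_contMDiffOn (contMDiffOn_chart (I := 𝓡 2) (x := c) (n := ∞))) ?_
      exact fun y hy => hgt (OpenPartialHomeomorph.map_source _ hy)
    refine (h1.contMDiffAt hnhds).congr_of_eventuallyEq ?_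
    filter_upwards [hnhds] with y hy
    exact chartExtend_of_mem hy
  · refine (contMDiffAt_id (I := 𝓡 2) (n := ∞)).congr_of_eventuallyEq ?_
    filter_upwards [(isClosed_chart_symm_image hKc hK).isOpen_compl.mem_nhds hx] with y hy
    exact chartExtend_of_notMem hg hy

/-- A point f z outside t would be fixed by f, so injectivity would give f z = z. This keeps the
chart target invariant, as needed to return to M through the inverse chart. -/
theorem mapsTo_of_eq_self_off {X : Type*} {f : X → X} (hf : Function.Injective f) {s t : Set X}
    (hst : s ⊆ t) (hs : ∀ z ∉ s, f z = z) : Set.MapsTo f t t := by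
  intro z hz
  by_contra h
  have := hf (hs (f z) fun h' => h (hst h'))
  rw [this] at h
  exact h hz

theorem chartExtend_chartExtend {g' : EuclideanSpace ℝ (Fin 2) → EuclideanSpace ℝ (Fin 2)}
    (hgt : Set.MapsTo g (chartAt (EuclideanSpace ℝ (Fin 2)) c).target
      (chartAt (EuclideanSpace ℝ (Fin 2)) c).target) (h : Function.LeftInverse g' g) (x : M) :
    chartExtend c g' (chartExtend c g x) = x := by
  by_cases hs : x ∈ (chartAt (EuclideanSpace ℝ (Fin 2)) c).source
  · have ht := hgt (OpenPartialHomeomorph.map_source _ hs)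
    rw [chartExtend_of_mem hs, chartExtend_of_mem (OpenPartialHomeomorph.map_target _ ht),
      OpenPartialHomeomorph.right_inv _ ht, h, OpenPartialHomeomorph.left_inv _ hs]
  · have h1 : ∀ k, chartExtend c k x = x := fun k => if_neg hs
    rw [h1, h1]

theorem exists_eq_chartExtend [IsManifold (𝓡 2) ∞ M] [T2Space M] (hKc : IsCompact K)
    (hK : K ⊆ (chartAt (EuclideanSpace ℝ (Fin 2)) c).target)
    (h : EuclideanSpace ℝ (Fin 2) ≃ₜ EuclideanSpace ℝ (Fin 2)) (hid : ∀ z ∉ K, h z = z)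
    (hd : ContDiff ℝ ∞ h) (hd' : ContDiff ℝ ∞ h.symm) :
    ∃ F : SurfaceDiff M, ∀ x, F x = chartExtend c h x := by
  have hid' : ∀ z ∉ K, h.symm z = z := fun z hz => by
    rw [Homeomorph.symm_apply_eq, hid z hz]
  have ht := mapsTo_of_eq_self_off h.injective hK hid
  have ht' := mapsTo_of_eq_self_off h.symm.injective hK hid'
  exact ⟨{  toFun := chartExtend c h
            invFun := chartExtend c h.symm
            left_inv := chartExtend_chartExtend ht h.left_inv
            right_inv := chartExtend_chartExtend ht' h.right_inv
            contMDiff_toFun := contMDiff_chartExtend hKc hK hid hd ht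
            contMDiff_invFun := contMDiff_chartExtend hKc hK hid' hd' ht' }, fun x => rfl⟩

/-- A jointly continuous family of maps supported in a fixed compact subset of the chart extends
to a jointly continuous family. -/
theorem continuous_chartExtend [T2Space M] (hKc : IsCompact K)
    (hK : K ⊆ (chartAt (EuclideanSpace ℝ (Fin 2)) c).target) {T : Type*} [TopologicalSpace T]
    {G : T → EuclideanSpace ℝ (Fin 2) → EuclideanSpace ℝ (Fin 2)}
    (hG : Continuous fun q : T × EuclideanSpace ℝ (Fin 2) => G q.1 q.2)
    (hid : ∀ t, ∀ z ∉ K, G t z = z)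
    (hGt : ∀ t, Set.MapsTo (G t) (chartAt (EuclideanSpace ℝ (Fin 2)) c).target
      (chartAt (EuclideanSpace ℝ (Fin 2)) c).target) :
    Continuous fun q : T × M => chartExtend c (G q.1) q.2 := by
  rw [continuous_iff_continuousAt]
  rintro ⟨t, x⟩
  by_cases hx : x ∈ (chartAt (EuclideanSpace ℝ (Fin 2)) c).symm '' K
  · have hs : x ∈ (chartAt (EuclideanSpace ℝ (Fin 2)) c).source := by
      obtain ⟨y, hy, rfl⟩ := hx
      exact OpenPartialHomeomorph.map_target _ (hK hy)
    have h1 : ContinuousAt (fun q : T × M => (chartAt (EuclideanSpace ℝ (Fin 2)) c).symm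
        (G q.1 (chartAt (EuclideanSpace ℝ (Fin 2)) c q.2))) (t, x) := by
      have h2 : ContinuousAt (fun q : T × M => (q.1, chartAt (EuclideanSpace ℝ (Fin 2)) c q.2))
          (t, x) :=
        continuousAt_fst.prodMk
          (ContinuousAt.comp (f := Prod.snd) (x := (t, x))
            (OpenPartialHomeomorph.continuousAt _ hs) continuousAt_snd)
      have h3 := ContinuousAt.comp (f := fun q : T × M =>
        (q.1, chartAt (EuclideanSpace ℝ (Fin 2)) c q.2)) hG.continuousAt h2
      exact ContinuousAt.comp (f := fun q : T × M =>
        G q.1 (chartAt (EuclideanSpace ℝ (Fin 2)) c q.2)) (x := (t, x))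
        (OpenPartialHomeomorph.continuousAt_symm _
          (hGt t (OpenPartialHomeomorph.map_source _ hs))) h3
    refine h1.congr ?_
    have hev := (continuousAt_snd (p := (t, x))).eventually
      ((chartAt (EuclideanSpace ℝ (Fin 2)) c).open_source.mem_nhds hs)
    filter_upwards [hev] with q hq
    exact (chartExtend_of_mem hq).symm
  · refine ContinuousAt.congr continuousAt_snd ?_
    have hev := (continuousAt_snd (p := (t, x))).eventually
      ((isClosed_chart_symm_image hKc hK).isOpen_compl.mem_nhds hx)
    filter_upwards [hev] with q hq
    exact (chartExtend_of_notMem (hid q.1) hq).symm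

end ChartExtend

end SurfaceDiff

namespace SurfaceDiff

/-! ### Diffeomorphisms that are the identity near a point -/

section Orientation

variable {M : Type*} [TopologicalSpace M] [ChartedSpace (EuclideanSpace ℝ (Fin 2)) M]

/-- If `o` and `o'` are orientations of a plane, then whether an automorphism carries `o` to `o'`
depends only on the sign of its determinant. -/
theorem map_orientation_eq_iff_of_det_mul_pos
    {L L' : EuclideanSpace ℝ (Fin 2) ≃ₗ[ℝ] EuclideanSpace ℝ (Fin 2)}
    (h : 0 < LinearMap.det (L : EuclideanSpace ℝ (Fin 2) →ₗ[ℝ] EuclideanSpace ℝ (Fin 2)) *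
      LinearMap.det (L' : EuclideanSpace ℝ (Fin 2) →ₗ[ℝ] EuclideanSpace ℝ (Fin 2)))
    (o o' : Orientation ℝ (EuclideanSpace ℝ (Fin 2)) (Fin 2)) :
    Orientation.map (Fin 2) L o = o' ↔ Orientation.map (Fin 2) L' o = o' := by
  have hcard : Fintype.card (Fin 2) = Module.finrank ℝ (EuclideanSpace ℝ (Fin 2)) := by simp
  rcases Orientation.eq_or_eq_neg o' o hcard with rfl | rfl
  · rw [Orientation.map_eq_iff_det_pos _ _ hcard, Orientation.map_eq_iff_det_pos _ _ hcard]
    rcases mul_pos_iff.1 h with h | h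
    · exact iff_of_true h.1 h.2
    · exact iff_of_false h.1.not_gt h.2.not_gt
  · rw [Orientation.map_eq_neg_iff_det_neg _ _ hcard, Orientation.map_eq_neg_iff_det_neg _ _ hcard]
    rcases mul_pos_iff.1 h with h | h
    · exact iff_of_false h.1.not_gt h.2.not_gt
    · exact iff_of_true h.1 h.2

variable [IsManifold (𝓡 2) ∞ M]

/-- The differential of `f` at `x`, read in the trivializations of the tangent bundle at `x₀` and
`f x₀`. -/
noncomputable def tangentCoordEquiv (f : SurfaceDiff M) {x₀ x : M}
    (hx : x ∈ (trivializationAt (EuclideanSpace ℝ (Fin 2)) (TangentSpace (𝓡 2) (M := M))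
        x₀).baseSet)
    (hfx : f x ∈ (trivializationAt (EuclideanSpace ℝ (Fin 2)) (TangentSpace (𝓡 2) (M := M))
        (f x₀)).baseSet) :
    EuclideanSpace ℝ (Fin 2) ≃L[ℝ] EuclideanSpace ℝ (Fin 2) :=
  (((trivializationAt (EuclideanSpace ℝ (Fin 2)) (TangentSpace (𝓡 2) (M := M))
      x₀).continuousLinearEquivAt ℝ x hx).symm.trans
    (f.mfderivToContinuousLinearEquiv (by simp) x)).trans
    ((trivializationAt (EuclideanSpace ℝ (Fin 2)) (TangentSpace (𝓡 2) (M := M))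
      (f x₀)).continuousLinearEquivAt ℝ (f x) hfx)

/-- In the trivializations at x₀ and f x₀ the orientations are constant near these points, so the
condition depends only on the sign of the determinant of the differential. That determinant is
continuous at x₀ and nonzero there. -/
theorem eventually_mapOrientation_iff (f : SurfaceDiff M)
    {o : ∀ x : M, Orientation ℝ (TangentSpace (𝓡 2) x) (Fin 2)} (ho : IsOrientation o) (x₀ : M) :
    ∀ᶠ x in 𝓝 x₀, f.mapOrientation x (o x) = o (f x) ↔ f.mapOrientation x₀ (o x₀) = o (f x₀) := by
  have : IsManifold (𝓡 2) 1 M := IsManifold.of_le (n := ∞) (by simp)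
  obtain ⟨a, ha⟩ := ho x₀
  obtain ⟨b, hb⟩ := ho (f x₀)
  have hcont : ContinuousAt (inTangentCoordinates (𝓡 2) (𝓡 2) id f (mfderiv (𝓡 2) (𝓡 2) f) x₀)
      x₀ :=
    ((f.contMDiff x₀).mfderiv_const (m := 0) (by simp)).continuousAt
  let d : M → ℝ := fun x =>
    (inTangentCoordinates (𝓡 2) (𝓡 2) id f (mfderiv (𝓡 2) (𝓡 2) f) x₀ x).det
  have hd : ContinuousAt d x₀ := ContinuousLinearMap.continuous_det.continuousAt.comp hcont
  have key : ∀ x (hx : x ∈ (trivializationAt (EuclideanSpace ℝ (Fin 2))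
        (TangentSpace (𝓡 2) (M := M)) x₀).baseSet)
      (hfx : f x ∈ (trivializationAt (EuclideanSpace ℝ (Fin 2)) (TangentSpace (𝓡 2) (M := M))
        (f x₀)).baseSet),
      d x = LinearMap.det ((f.tangentCoordEquiv hx hfx).toLinearEquiv :
        EuclideanSpace ℝ (Fin 2) →ₗ[ℝ] EuclideanSpace ℝ (Fin 2)) := by
    intro x hx hfx
    have h := ContinuousLinearMap.inCoordinates_eq (ϕ := mfderiv (𝓡 2) (𝓡 2) f x) hx hfx
    change ContinuousLinearMap.det (ContinuousLinearMap.inCoordinates _ _ _ _ _ _ _ _ _) = _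
    erw [h]
    rfl
  have key' : ∀ x (hx : x ∈ (trivializationAt (EuclideanSpace ℝ (Fin 2))
        (TangentSpace (𝓡 2) (M := M)) x₀).baseSet)
      (hfx : f x ∈ (trivializationAt (EuclideanSpace ℝ (Fin 2)) (TangentSpace (𝓡 2) (M := M))
        (f x₀)).baseSet),
      Orientation.map (Fin 2) ((trivializationAt (EuclideanSpace ℝ (Fin 2))
        (TangentSpace (𝓡 2) (M := M)) x₀).continuousLinearEquivAt ℝ x hx).toLinearEquiv (o x) = a →
      Orientation.map (Fin 2) ((trivializationAt (EuclideanSpace ℝ (Fin 2))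
        (TangentSpace (𝓡 2) (M := M)) (f x₀)).continuousLinearEquivAt ℝ (f x) hfx).toLinearEquiv
          (o (f x)) = b →
      (f.mapOrientation x (o x) = o (f x) ↔
        Orientation.map (Fin 2) (f.tangentCoordEquiv hx hfx).toLinearEquiv a = b) := by
    rintro x hx hfx rfl rfl
    have h : Orientation.map (Fin 2) (f.tangentCoordEquiv hx hfx).toLinearEquiv
        (Orientation.map (Fin 2) ((trivializationAt (EuclideanSpace ℝ (Fin 2))
          (TangentSpace (𝓡 2) (M := M)) x₀).continuousLinearEquivAt ℝ x hx).toLinearEquiv (o x)) =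
        Orientation.map (Fin 2) ((trivializationAt (EuclideanSpace ℝ (Fin 2))
          (TangentSpace (𝓡 2) (M := M)) (f x₀)).continuousLinearEquivAt ℝ (f x) hfx).toLinearEquiv
          (f.mapOrientation x (o x)) := by
      have hL : ((trivializationAt (EuclideanSpace ℝ (Fin 2))
          (TangentSpace (𝓡 2) (M := M)) x₀).continuousLinearEquivAt ℝ x hx).toLinearEquiv.trans
          (f.tangentCoordEquiv hx hfx).toLinearEquiv =
          (f.mfderivToContinuousLinearEquiv (by simp) x).toLinearEquiv.trans
          ((trivializationAt (EuclideanSpace ℝ (Fin 2)) (TangentSpace (𝓡 2) (M := M))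
            (f x₀)).continuousLinearEquivAt ℝ (f x) hfx).toLinearEquiv := by
        ext1 v
        exact congrArg (fun w => (trivializationAt (EuclideanSpace ℝ (Fin 2))
          (TangentSpace (𝓡 2) (M := M)) (f x₀)).continuousLinearEquivAt ℝ (f x) hfx
          (f.mfderivToContinuousLinearEquiv (by simp) x w))
          (ContinuousLinearEquiv.symm_apply_apply _ v)
      have htr : ∀ {V V' V'' : Type} [AddCommGroup V] [Module ℝ V] [AddCommGroup V'] [Module ℝ V']
          [AddCommGroup V''] [Module ℝ V''] (L : V ≃ₗ[ℝ] V') (L' : V' ≃ₗ[ℝ] V'')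
          (w : Orientation ℝ V (Fin 2)), Orientation.map (Fin 2) L' (Orientation.map (Fin 2) L w) =
            Orientation.map (Fin 2) (L.trans L') w := by
        intro V V' V'' _ _ _ _ _ _ L L' w
        induction w using Module.Ray.ind with
        | h v hv => rfl
      unfold mapOrientation
      rw [htr, htr, hL]
    rw [h, (Orientation.map (Fin 2) _).injective.eq_iff]
  obtain ⟨hx₀, ha₀⟩ := ha.self_of_nhds
  obtain ⟨hfx₀, hb₀⟩ := hb.self_of_nhds
  have hd₀ : d x₀ ≠ 0 := by
    rw [key x₀ hx₀ hfx₀]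
    exact (LinearEquiv.isUnit_det' _).ne_zero
  have hpos : ∀ᶠ x in 𝓝 x₀, 0 < d x * d x₀ :=
    (hd.mul continuousAt_const).eventually (lt_mem_nhds (mul_self_pos.2 hd₀))
  filter_upwards [ha, f.continuous.continuousAt.eventually hb, hpos] with x hax hbx hdx
  obtain ⟨hx, hax⟩ := hax
  obtain ⟨hfx, hbx⟩ := hbx
  rw [key' x hx hfx hax hbx, key' x₀ hx₀ hfx₀ ha₀ hb₀]
  rw [key x hx hfx, key x₀ hx₀ hfx₀] at hdx
  exact map_orientation_eq_iff_of_det_mul_pos hdx a b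

/-- On a connected surface, a diffeomorphism that is the identity near some point preserves
orientations. -/
theorem mem_orientationPreserving_of_eventuallyEq_id [PreconnectedSpace M] {f : SurfaceDiff M}
    {x₀ : M} (hf : f =ᶠ[𝓝 x₀] id) : f ∈ orientationPreserving M := by
  intro o ho
  have hclopen : IsClopen {x | f.mapOrientation x (o x) = o (f x)} := by
    constructor
    · rw [← isOpen_compl_iff, isOpen_iff_mem_nhds]
      intro x hx
      filter_upwards [f.eventually_mapOrientation_iff ho x] with y hy h
      exact hx (hy.1 h)
    · rw [isOpen_iff_mem_nhds]
      intro x hx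
      filter_upwards [f.eventually_mapOrientation_iff ho x] with y hy
      exact hy.2 hx
  have hx₀ : x₀ ∈ {x | f.mapOrientation x (o x) = o (f x)} := by
    -- The orientations at f x₀ and at x₀ belong to different tangent spaces. Both spaces are by
    -- definition the model plane, where the orientations can be compared.
    have h1 : ∀ y, y = x₀ →
        (o y : Orientation ℝ (EuclideanSpace ℝ (Fin 2)) (Fin 2)) = o x₀ := by
      rintro y rfl
      rfl
    have h2 : ((f.mfderivToContinuousLinearEquiv (by simp) x₀).toLinearEquiv :
        EuclideanSpace ℝ (Fin 2) ≃ₗ[ℝ] EuclideanSpace ℝ (Fin 2)) = LinearEquiv.refl ℝ _ := by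
      ext1 v
      have h3 : mfderiv (𝓡 2) (𝓡 2) f x₀ = mfderiv (𝓡 2) (𝓡 2) (id : M → M) x₀ := hf.mfderiv_eq
      rw [mfderiv_id] at h3
      exact congrArg (fun L => L v) h3
    have h4 : (f.mapOrientation x₀ (o x₀) : Orientation ℝ (EuclideanSpace ℝ (Fin 2)) (Fin 2)) =
        o x₀ := by
      refine (congrArg (fun L : EuclideanSpace ℝ (Fin 2) ≃ₗ[ℝ] EuclideanSpace ℝ (Fin 2) =>
        Orientation.map (Fin 2) L (o x₀)) h2).trans ?_
      exact DFunLike.congr_fun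
        (Orientation.map_refl (R := ℝ) (M := EuclideanSpace ℝ (Fin 2)) (Fin 2)) (o x₀)
    exact h4.trans (h1 (f x₀) hf.self_of_nhds).symm
  have := hclopen.eq_univ ⟨x₀, hx₀⟩
  exact Set.eq_univ_iff_forall.1 this

end Orientation

end SurfaceDiff

namespace SurfaceDiff

/-! ### Moving finite sets by isotopies -/

section Isotopy

variable {M : Type*} [TopologicalSpace M] [ChartedSpace (EuclideanSpace ℝ (Fin 2)) M]
  [CompactSpace M] [T2Space M]

/-- For the compact-open topology joint continuity of the family suffices, by currying; the
derivatives need no control in t. -/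
theorem mem_idComponent_of_path {D : Subgroup (SurfaceDiff M)} {F : unitInterval → SurfaceDiff M}
    (hF : Continuous fun q : unitInterval × M => F q.1 q.2) (hD : ∀ t, F t ∈ D) (h0 : F 0 = 1) :
    F 1 ∈ idComponent D := by
  have hc : Continuous fun t => (⟨F t, hD t⟩ : D) :=
    Continuous.subtype_mk (continuous_induced_rng.2
      (ContinuousMap.continuous_of_continuous_uncurry _ hF)) _
  exact ⟨⟨F 1, hD 1⟩, ⟨{ toFun := fun t => ⟨F t, hD t⟩
                         continuous_toFun := hc
                         source' := Subtype.ext h0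
                         target' := rfl }⟩, rfl⟩

variable [IsManifold (𝓡 2) ∞ M] [ConnectedSpace M] {D : Subgroup (SurfaceDiff M)}

/-- Near `p`, every point is the image of `p` under an isotopy fixing a given finite set. -/
theorem eventually_exists_idComponent (hD : D = ⊤ ∨ D = orientationPreserving M) (C : Finset M)
    {p : M} (hp : p ∉ C) :
    ∀ᶠ y in 𝓝 p, ∃ h ∈ idComponent D, h p = y ∧ ∀ c ∈ C, h c = c := by
  let e := chartAt (EuclideanSpace ℝ (Fin 2)) p
  have hps : p ∈ e.source := mem_chart_source _ p
  have hCo : IsOpen ((C : Set M)ᶜ) := C.finite_toSet.isClosed.isOpen_compl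
  have hpW : e p ∈ e.target ∩ e.symm ⁻¹' (C : Set M)ᶜ :=
    ⟨e.map_source hps, by rw [Set.mem_preimage, e.left_inv hps]; simpa using hp⟩
  obtain ⟨R, hR, hball⟩ := Metric.isOpen_iff.1 (e.isOpen_inter_preimage_symm hCo) _ hpW
  have hr : 0 < R / 2 := by positivity
  let K := Metric.closedBall (e p) (R / 2)
  have hKball : K ⊆ Metric.ball (e p) R := Metric.closedBall_subset_ball (by linarith)
  have hKt : K ⊆ e.target := fun z hz => (hball (hKball hz)).1
  have hKc : IsCompact K := isCompact_closedBall _ _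
  -- A chart point at distance 3R/4, between the radius R/2 of the support and R. All the
  -- diffeomorphisms below are the identity near its image in M, hence preserve orientations.
  obtain ⟨q, hqt, hqK⟩ : ∃ q ∈ e.target, q ∉ K := by
    obtain ⟨v, hv⟩ := exists_norm_eq (EuclideanSpace ℝ (Fin 2)) (c := 3 * R / 4) (by positivity)
    refine ⟨e p + v, (hball ?_).1, ?_⟩
    · rw [Metric.mem_ball, dist_self_add_left, hv]
      linarith
    · rw [Metric.mem_closedBall, dist_self_add_left, hv]
      linarith
  obtain ⟨φ, hφc, hφ1, hφ0, ε, hε, hφ⟩ := exists_bump_homeomorph (e p) hr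
  have hnear : ∀ᶠ y in 𝓝 p, ‖e y - e p‖ < ε := by
    have := (e.continuousAt hps).eventually (Metric.ball_mem_nhds _ hε)
    filter_upwards [this] with y hy
    rwa [← dist_eq_norm]
  filter_upwards [hnear, e.open_source.mem_nhds hps] with y hy hys
  -- At time t the bump displacement is t(e y - e p), which stays below the bound ε for all t in [0,
  -- 1].
  have hv : ∀ t : unitInterval, ‖(t : ℝ) • (e y - e p)‖ < ε := fun t => by
    rw [norm_smul, Real.norm_of_nonneg t.2.1]
    exact (mul_le_of_le_one_left (norm_nonneg _) t.2.2).trans_lt hy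
  choose h hh hd hd' using fun t => hφ _ (hv t)
  have hid : ∀ t, ∀ z ∉ K, h t z = z := fun t z hz => by
    rw [hh, hφ0 z hz, zero_smul, add_zero]
  choose F hF using fun t => exists_eq_chartExtend (M := M) (c := p) hKc hKt (h t) (hid t) (hd t)
    (hd' t)
  have hFoff : ∀ t, ∀ x ∉ e.symm '' K, F t x = x := fun t x hx => by
    rw [hF, chartExtend_of_notMem (hid t) hx]
  have hFD : ∀ t, F t ∈ D := fun t => by
    rcases hD with rfl | rfl
    · trivial
    · refine mem_orientationPreserving_of_eventuallyEq_id (x₀ := e.symm q) ?_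
      have hq : e.symm q ∈ (e.symm '' K)ᶜ := by
        rintro ⟨z, hz, hzq⟩
        exact hqK (e.symm.injOn (hKt hz) hqt hzq ▸ hz)
      filter_upwards [(isClosed_chart_symm_image hKc hKt).isOpen_compl.mem_nhds hq] with x hx
      exact hFoff t x hx
  have hF0 : F 0 = 1 := by
    refine Diffeomorph.ext fun x => ?_
    rw [hF, one_apply]
    by_cases hx : x ∈ e.source
    · rw [chartExtend_of_mem hx, hh]
      simpa using e.left_inv hx
    · exact if_neg hx
  have hFc : Continuous fun q : unitInterval × M => F q.1 q.2 := by
    simp only [hF]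
    refine continuous_chartExtend (G := fun t => h t) hKc hKt ?_ hid
      fun t => mapsTo_of_eq_self_off (h t).injective hKt (hid t)
    simp only [hh]
    fun_prop
  refine ⟨F 1, mem_idComponent_of_path hFc hFD hF0, ?_, fun c hc => hFoff 1 c ?_⟩
  · rw [hF, chartExtend_of_mem hps, hh, hφ1, Set.Icc.coe_one, one_smul, one_smul]
    change e.symm (e p + (e y - e p)) = y
    rw [add_sub_cancel, e.left_inv hys]
  · rintro ⟨z, hz, rfl⟩
    exact (hball (hKball hz)).2 hc

/-- The isotopies fixing a finite set act transitively on its complement. -/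
theorem exists_idComponent_apply_eq (hD : D = ⊤ ∨ D = orientationPreserving M) (C : Finset M)
    {p q : M} (hp : p ∉ C) (hq : q ∉ C) :
    ∃ h ∈ idComponent D, h p = q ∧ ∀ c ∈ C, h c = c := by
  have hrank : 1 < Module.rank ℝ (EuclideanSpace ℝ (Fin 2)) := by
    rw [← Module.finrank_eq_rank, finrank_euclideanSpace_fin]
    norm_num
  -- Being related by such an isotopy is symmetric and transitive, and it holds locally; on a
  -- connected set it therefore relates any two points.
  refine (isPreconnected_compl_finset hrank C).induction₂
    (fun p q => ∃ h ∈ idComponent D, h p = q ∧ ∀ c ∈ C, h c = c) ?_ ?_ ?_ hp hq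
  · intro x hx
    exact (eventually_exists_idComponent hD C hx).filter_mono nhdsWithin_le_nhds
  · rintro x y z - - - ⟨f, hf, hfx, hfC⟩ ⟨g, hg, hgy, hgC⟩
    exact ⟨g * f, mul_mem hg hf, by rw [mul_apply, hfx, hgy],
      fun c hc => by rw [mul_apply, hfC c hc, hgC c hc]⟩
  · rintro x y - - ⟨f, hf, hfx, hfC⟩
    refine ⟨f⁻¹, inv_mem hf, by rw [← hfx, inv_apply_self], fun c hc => ?_⟩
    conv_lhs => rw [← hfC c hc]
    exact inv_apply_self f c

/-- Any two finite sets with the same number of elements are related by an isotopy. -/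
theorem exists_idComponent_image_eq (hD : D = ⊤ ∨ D = orientationPreserving M) (A B : Finset M)
    (hAB : A.card = B.card) : ∃ h ∈ idComponent D, h '' (A : Set M) = B := by
  classical
  induction A using Finset.induction_on generalizing B with
  | empty =>
    obtain rfl : B = ∅ := Finset.card_eq_zero.1 (by simpa using hAB.symm)
    exact ⟨1, one_mem _, by simp⟩
  | insert a A ha ih =>
    rw [Finset.card_insert_of_notMem ha] at hAB
    obtain ⟨b, B, hb, rfl, hB⟩ := Finset.card_eq_succ.1 hAB.symm
    obtain ⟨f, hf, hfA⟩ := ih B hB.symm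
    have hfa : f a ∉ B := fun h => by
      rw [← Finset.mem_coe, ← hfA] at h
      obtain ⟨a', ha', h⟩ := h
      exact ha (f.injective h ▸ ha')
    -- Now f A = B, and g carries the remaining point f a to b without disturbing B.
    obtain ⟨g, hg, hga, hgB⟩ := exists_idComponent_apply_eq hD B hfa hb
    refine ⟨g * f, mul_mem hg hf, ?_⟩
    change (fun x => g (f x)) '' _ = _
    rw [← Set.image_image (fun x => g x) (fun x => f x), Finset.coe_insert, Finset.coe_insert,
      Set.image_insert_eq, Set.image_insert_eq, hfA, hga]
    congr 1
    exact (Set.image_congr fun c hc => hgB c hc).trans (Set.image_id _)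

end Isotopy

/-! ### The exact sequence -/

section Exact

variable {M : Type*} [TopologicalSpace M] [ChartedSpace (EuclideanSpace ℝ (Fin 2)) M]
  [CompactSpace M] [T2Space M]

theorem mem_idComponent_iff {D : Subgroup (SurfaceDiff M)} (f : D) :
    (f : SurfaceDiff M) ∈ idComponent D ↔ Joined 1 f :=
  ⟨fun ⟨_, hg, hgf⟩ => Subtype.ext hgf ▸ hg, fun h => ⟨f, h, rfl⟩⟩

/-- A path in D(Q) starting in D₀ remains in D₀, so it already joins its ends in D₀ ∩ D(Q). -/
theorem reducedToMarked_injective (D : Subgroup (SurfaceDiff M)) (Q : Finset M) :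
    Function.Injective (reducedToMarked D Q) := by
  rintro ⟨f⟩ ⟨g⟩ h
  obtain ⟨γ⟩ : Joined (Subgroup.inclusion (reducedMarked_le D Q) f)
      (Subgroup.inclusion (reducedMarked_le D Q) g) := Quotient.exact h
  have hincl := continuous_inclusion (marked_le D Q)
  have hf : Joined 1 (Subgroup.inclusion (marked_le D Q)
      (Subgroup.inclusion (reducedMarked_le D Q) f)) :=
    (mem_idComponent_iff _).1 f.2.1
  have hmem : ∀ t, (γ t : SurfaceDiff M) ∈ reducedMarked D Q := fun t => by
    refine ⟨?_, (γ t).2⟩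
    refine (mem_idComponent_iff (Subgroup.inclusion (marked_le D Q) (γ t))).2 (hf.trans ?_)
    -- The initial piece of γ up to time t, reparametrized to the unit interval.
    have h1 : Joined (γ 0) (γ t) := ⟨{ toFun := fun s => γ (s * t)
                                       continuous_toFun := by fun_prop
                                       source' := by simp
                                       target' := by simp }⟩
    rw [γ.source] at h1
    exact h1.map hincl
  have h0 : (⟨γ 0, hmem 0⟩ : reducedMarked D Q) = f :=
    Subtype.ext (congrArg (Subgroup.subtype _) γ.source)
  have h1 : (⟨γ 1, hmem 1⟩ : reducedMarked D Q) = g :=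
    Subtype.ext (congrArg (Subgroup.subtype _) γ.target)
  exact Quotient.sound ⟨{ toFun := fun t => ⟨γ t, hmem t⟩
                          continuous_toFun :=
                            (continuous_subtype_val.comp γ.continuous).subtype_mk _
                          source' := h0
                          target' := h1 }⟩

theorem range_reducedToMarked (D : Subgroup (SurfaceDiff M)) (Q : Finset M) :
    (reducedToMarked D Q).range = (forgetMarked D Q).ker := by
  ext ⟨f⟩
  constructor
  · rintro ⟨⟨g⟩, hg⟩
    rw [← hg]
    exact Quotient.sound ((mem_idComponent_iff _).1 g.2.1).symm
  · intro h
    have hj : Joined (Subgroup.inclusion (marked_le D Q) f) 1 := Quotient.exact h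
    exact ⟨ZerothHomotopy.mk ⟨f, (mem_idComponent_iff _).2 hj.symm, f.2⟩, rfl⟩

/-- An element h of D₀ carrying f(Q) to Q turns f into h ∘ f in D(Q). A path from h to 1, composed
with f, shows that the class in π₀ D is unchanged. -/
theorem forgetMarked_surjective [IsManifold (𝓡 2) ∞ M] [ConnectedSpace M] (Q : Finset M)
    {D : Subgroup (SurfaceDiff M)} (hD : D = ⊤ ∨ D = orientationPreserving M) :
    Function.Surjective (forgetMarked D Q) := by
  classical
  rintro ⟨f⟩
  obtain ⟨h, hh, hQ⟩ := exists_idComponent_image_eq hD (Q.image fun x => f.1 x) Q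
    (Finset.card_image_of_injective _ f.1.injective)
  obtain ⟨h, hh1, rfl⟩ := hh
  have hmem : D.subtype h * f.1 ∈ marked D Q := by
    refine ⟨mul_mem h.2 f.2, ?_⟩
    change (fun x => D.subtype h (f.1 x)) '' (Q : Set M) = Q
    rw [← Set.image_image (fun x => D.subtype h x) (fun x => f.1 x), ← Finset.coe_image]
    exact hQ
  refine ⟨ZerothHomotopy.mk ⟨_, hmem⟩, ?_⟩
  have hj : Joined (1 : D) h := hh1
  have := hj.symm.mul (Joined.refl f)
  rw [one_mul] at this
  exact Quotient.sound this

end Exact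

end SurfaceDiff

theorem mainTheorem5 {M : Type*} [TopologicalSpace M]
    [ChartedSpace (EuclideanSpace ℝ (Fin 2)) M] [IsManifold (𝓡 2) ∞ M]
    [T2Space M] [CompactSpace M] [ConnectedSpace M] (Q : Finset M)
    (D : Subgroup (SurfaceDiff M)) (hD : D = ⊤ ∨ D = SurfaceDiff.orientationPreserving M) :
    Function.Injective (SurfaceDiff.reducedToMarked D Q) ∧
      (SurfaceDiff.reducedToMarked D Q).range = (SurfaceDiff.forgetMarked D Q).ker ∧
      Function.Surjective (SurfaceDiff.forgetMarked D Q) :=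
  ⟨SurfaceDiff.reducedToMarked_injective D Q, SurfaceDiff.range_reducedToMarked D Q,
    SurfaceDiff.forgetMarked_surjective Q hD⟩
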